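/- Conventions. Let $\mathsf{Poset}$ be the category of posets and monotone maps, $\Phi$ a poset (of conditions), and $X^\Phi$ the poset of monotone maps $\Phi\to X$ with the pointwise order. $\mathsf{Kl}(-^\Phi)$ is the Kleisli category of the reader monad $-^\Phi$ (unit $x\mapsto(\varphi\mapsto x)$, multiplication $D\mapsto(\varphi\mapsto D(\varphi)(\varphi))$); a Kleisli arrow $f:X\rightsquigarrow Y$ is a monotone map $X\to Y^\Phi$, with slices $f_\varphi(x)=f(x)(\varphi)$ and uncurrying $\check f:X\times\Phi\to Y$, and $\circ$ is Kleisli composition. A monotone map $X\to Y$ is regarded as a (pure) Kleisli arrow by composing it with the unit; $\rho_X:X\rightsquigarrow X\times\Phi$ is $\rho_X(x)(\varphi)=(x,\varphi)$. Let $H:\mathsf{Poset}\to\mathsf{Poset}$ be a functor and $\hat H$ an extension of $H$, i.e. an endofunctor of $\mathsf{Kl}(-^\Phi)$ that is $H$ on objects and on pure arrows. A version filter for $\hat H$ is a family of natural transformations $\mathrm{filt}^\varphi:\hat H\to\hat H$ ($\varphi\in\Phi$) such that $\hat H(c_\varphi)\circ\mathrm{filt}^\varphi_X=\hat H(\rho_X)\circ\mathrm{filt}^\varphi_X$,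 where $c_\varphi:X\rightsquigarrow X\times\Phi$ is the pure arrow $x\mapsto(x,\varphi)$, and such that for all $\varphi$ and $X$ the maps $((\mathrm{filt}^\psi_X)_\varphi:HX\to HX)_{\psi\in\Phi}$ are jointly monic. A coalgebra $\alpha:X\rightsquigarrow\hat HX$ preserves upgrades if $(\mathrm{filt}^\psi_X\circ\alpha)_\varphi=(\mathrm{filt}^\psi_X\circ\alpha)_\psi$ for $\psi\le\varphi$, and $(\mathrm{filt}^\psi_X\circ\alpha)_\varphi$ is constant for $\psi\not\le\varphi$. Put $\gamma_\varphi=(\mathrm{filt}^\varphi_X)_\varphi\cdot\alpha_\varphi:X\to HX$. A family of relations $R_\varphi\subseteq X\times X$ ($\varphi\in\Phi$) with $R_\varphi\subseteq R_{\psi}$ whenever $\psi\le\varphi$ is a conditional congruence for $\alpha$ if, for every $\varphi$, $H\kappa_\varphi\cdot\gamma_\varphi$ identifies all pairs in $R_\varphi$, where $\kappa_\varphi:X\to X/R_\varphi$ is the coequaliser in $\mathsf{Poset}$ of the projections of $R_\varphi$. It is a conditional bisimulation if every $R_\varphi$ is a bisimulation for the $H$-coalgebra $\gamma_\varphi$,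 i.e. is given by a jointly monic span $p_1,p_2:P\to X$ of posets for which there is $r:P\to HP$ with $\gamma_\varphi\cdot p_i=Hp_i\cdot r$ for $i=1,2$. States $x_1,x_2$ are conditionally congruent (conditionally bisimilar) under $\varphi$ if $(x_1,x_2)\in R_\varphi$ for some conditional congruence (conditional bisimulation) $R$. The minimisation algorithm on $\alpha$: a pseudo-factorisation of $f:X\rightsquigarrow Y$ is $f=m\circ e$ with $e=e'\circ\rho_X$, where $\check f=m\cdot e'$, $e':X\times\Phi\to Z$ is a regular epimorphism of $\mathsf{Poset}$ and $m:Z\to Y$ an order-preserving injection. Let $d_0:X\rightsquigarrow 1$ be the final arrow; given $d_i$, pseudo-factorise $d_i=m_i\circ e_i$ with $e_i:X\rightsquigarrow Z_i$, and put $d_{i+1}=\hat He_i\circ\alpha$. The algorithm terminates at $n$ with output $e_n$ if there is an isomorphism of posets $u:Z_{n+1}\to Z_n$ with $e_n=u\circ e_{n+1}$. Theorem. (1) Suppose that $H$ preserves the class of order-preserving injections, that $\hat H$ has a version filter and that $\alpha:X\rightsquigarrow\hat HX$ preserves upgrades. If the algorithm run on $\alpha$ terminates with output $e_n$, then for all $\varphi\in\Phi$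 and $x_1,x_2\in X$: the states $x_1,x_2$ are conditionally congruent under $\varphi$ if and only if $\check e_n(x_1,\varphi)=\check e_n(x_2,\varphi)$. If moreover $H$ preserves weak pullbacks, then $x_1,x_2$ are conditionally bisimilar under $\varphi$ if and only if $\check e_n(x_1,\varphi)=\check e_n(x_2,\varphi)$. (2) This applies to conditional transition systems. Let $X$ and $A$ be sets (discrete posets) and $f:X\times A\to(\mathcal P X,\supseteq)^\Phi$ a CTS. Call $x_1\sim_\varphi x_2$ if $(x_1,x_2)\in R_\varphi$ for a family $(R_\varphi)_{\varphi\in\Phi}$ such that each $R_\varphi$ is a bisimulation on the labelled transition system $f(-,-)(\varphi)$ and $R_\varphi\subseteq R_\psi$ for $\psi\le\varphi$. Consider one of the following: (a) $H=\mathcal P(-\times\Phi)^A$ ($\mathcal P$ the powerset ordered by inclusion, with direct images), $\hat Hg(p)(\varphi)(a)=\{(g(x)(\varphi'),\varphi')\mid(x,\varphi')\in p(a)\}$, $\alpha(x)(\varphi)(a)=\{(x',\varphi')\mid x'\in f(x,a)(\varphi'),\ \varphi'\le\varphi\}$, and $\mathrm{filt}^\varphi$ keeping exactly the pairs with second component $\varphi$;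 (b) $\Phi$ discrete and $H=\mathcal P(-)^A$, or (c) $\Phi$ discrete and $H=(\mathcal P(-),\supseteq)^A$, both with $\hat Hg(p)(\varphi)(a)=\{g(x)(\varphi)\mid x\in p(a)\}$, $\alpha(x)(\varphi)(a)=f(x,a)(\varphi)$, and $\mathrm{filt}^\varphi(p)(\psi)=p$ if $\psi=\varphi$ and $\mathrm{filt}^\varphi(p)(\psi)(a)=\emptyset$ for all $a$ otherwise. In each case $H$ preserves order-preserving injections and weak pullbacks, $\alpha$ preserves upgrades with respect to the version filter, and if the algorithm run on $\alpha$ terminates with output $e_n$, then $x_1\sim_\varphi x_2$ if and only if $\check e_n(x_1,\varphi)=\check e_n(x_2,\varphi)$. -/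

import Mathlib

open CategoryTheory

universe u

-- So that `X ⟶ Y` is always elaborated through the category structure.
attribute [-instance] catToReflQuiver

namespace CondTS

/-! ### The reader monad on the category of posets and its Kleisli category -/

section Reader

variable (Φ : Type u) [PartialOrder Φ]

/-- The reader monad `X ↦ X^Φ` on posets: `X^Φ` is the set of monotone maps `Φ → X` with the
pointwise order, the unit sends `x` to the constant map at `x`, and the multiplication is
`D ↦ (φ ↦ D φ φ)`. -/
def reader : Monad PartOrd.{u} where
  obj X := PartOrd.of (Φ →o X)
  map {X Y} f := PartOrd.ofHom (X := Φ →o X) (Y := Φ →o Y)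
    ⟨fun C => f.hom.comp C, fun _ _ h φ => f.hom.monotone (h φ)⟩
  map_id _ := rfl
  map_comp _ _ := rfl
  η :=
    { app := fun X => PartOrd.ofHom (X := X) (Y := Φ →o X)
        ⟨fun x => OrderHom.const Φ x, fun _ _ h _ => h⟩
      naturality := fun _ _ _ => rfl }
  μ :=
    { app := fun X => PartOrd.ofHom (X := Φ →o (Φ →o X)) (Y := Φ →o X)
        ⟨fun D => ⟨fun φ => D φ φ, fun _ ψ h => le_trans (D.monotone h _) ((D ψ).monotone h)⟩,
          fun _ _ h φ => h φ φ⟩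
      naturality := fun _ _ _ => rfl }
  assoc _ := rfl
  left_unit _ := rfl
  right_unit _ := rfl

/-- The Kleisli category of the reader monad. -/
abbrev Kl := Kleisli (reader.{u} Φ)

/-- A poset, regarded as an object of the Kleisli category. -/
abbrev kl (X : PartOrd.{u}) : Kl Φ := Kleisli.mk (reader Φ) X

/-- The inclusion of posets into the Kleisli category, as pure arrows. -/
abbrev pureFunctor : PartOrd.{u} ⥤ Kl Φ := Kleisli.Adjunction.toKleisli (reader Φ)

/-- A monotone map `f`, regarded as a pure Kleisli arrow `x ↦ (φ ↦ f x)`. -/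
def klPure {X Y : PartOrd.{u}} (f : X ⟶ Y) : kl Φ X ⟶ kl Φ Y := (pureFunctor Φ).map f

/-- The functor `X ↦ X × Φ` on posets (with the componentwise order). -/
def prodFunctor : PartOrd.{u} ⥤ PartOrd.{u} where
  obj X := PartOrd.of (X × Φ)
  map {X Y} f := PartOrd.ofHom (X := X × Φ) (Y := Y × Φ)
    ⟨fun p => (f p.1, p.2), fun _ _ h => ⟨f.hom.monotone h.1, h.2⟩⟩
  map_id _ := rfl
  map_comp _ _ := rfl

variable {Φ}

/-- A Kleisli arrow `X ⇝ Y` as the monotone map `X → Y^Φ` that it is. -/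
def klFun {X Y : PartOrd.{u}} (f : kl Φ X ⟶ kl Φ Y) : X →o (Φ →o Y) := f.of.hom

/-- The Kleisli arrow `X ⇝ Y` given by a monotone map `X → Y^Φ`. -/
def klMk {X Y : PartOrd.{u}} (f : X →o (Φ →o Y)) : kl Φ X ⟶ kl Φ Y :=
  Kleisli.Hom.mk (PartOrd.ofHom (X := X) (Y := Φ →o Y) f)

/-- `slice φ f` is the monotone map `f_φ : X → Y`, `f_φ x = f x φ`. -/
def slice {X Y : PartOrd.{u}} (φ : Φ) (f : kl Φ X ⟶ kl Φ Y) : X ⟶ Y :=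
  PartOrd.ofHom (X := X) (Y := Y)
    ⟨fun x => klFun f x φ, fun _ _ h => (klFun f).monotone h φ⟩

/-- The uncurrying `X × Φ → Y` of a Kleisli arrow `X ⇝ Y`. -/
def uncurry {X Y : PartOrd.{u}} (f : kl Φ X ⟶ kl Φ Y) : (prodFunctor Φ).obj X ⟶ Y :=
  PartOrd.ofHom (X := X × Φ) (Y := Y)
    ⟨fun p => klFun f p.1 p.2,
      fun p q h => le_trans ((klFun f).monotone h.1 p.2) ((klFun f q.1).monotone h.2)⟩

/-- Two Kleisli arrows with the same underlying function are equal. -/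
theorem kl_ext {X Y : PartOrd.{u}} {f g : kl Φ X ⟶ kl Φ Y}
    (h : ∀ x φ, klFun f x φ = klFun g x φ) : f = g := by
  apply Kleisli.hom_ext
  apply PartOrd.ext
  intro x
  exact OrderHom.ext _ _ (funext (h x))

/-- Slices commute with composition. -/
theorem klFun_comp {X Y Z : PartOrd.{u}} (f : kl Φ X ⟶ kl Φ Y) (g : kl Φ Y ⟶ kl Φ Z)
    (x : X) (φ : Φ) : klFun (f ≫ g) x φ = klFun g (klFun f x φ) φ := rfl

/-- The universal arrow `ρ_X : X ⇝ X × Φ`, `ρ_X x φ = (x, φ)`, of the reflection of the Kleisli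
category onto its subcategory of pure arrows. -/
def rho (X : PartOrd.{u}) : kl Φ X ⟶ kl Φ ((prodFunctor Φ).obj X) :=
  klMk (X := X) (Y := (prodFunctor Φ).obj X)
    ⟨fun x => ⟨fun φ => ((x, φ) : X × Φ), fun _ _ h => ⟨le_rfl, h⟩⟩, fun _ _ h _ => ⟨h, le_rfl⟩⟩

/-- Posets form a reflective subcategory: every Kleisli arrow factors through `ρ_X` by exactly
one pure arrow, its reflection, which is its uncurrying. -/
theorem rho_universal {X Y : PartOrd.{u}} (f : kl Φ X ⟶ kl Φ Y)
    (g : (prodFunctor Φ).obj X ⟶ Y) : rho X ≫ klPure Φ g = f ↔ g = uncurry f := by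
  constructor
  · rintro rfl
    rfl
  · rintro rfl
    rfl

variable (Φ) in
/-- The final Kleisli arrow `X ⇝ 1`. -/
def toOne (X : PartOrd.{u}) : kl Φ X ⟶ kl Φ (PartOrd.of PUnit.{u + 1}) :=
  klPure Φ (PartOrd.ofHom (X := X) (Y := PUnit.{u + 1}) (OrderHom.const X PUnit.unit))

theorem eq_toOne {X : PartOrd.{u}} (f : kl Φ X ⟶ kl Φ (PartOrd.of PUnit.{u + 1})) :
    f = toOne Φ X := rfl

/-! ### Extensions of functors, version filters -/

variable (Φ) in
/-- An extension to the Kleisli category of an endofunctor `H` of posets: a functor `Ĥ` on the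
Kleisli category that is `H` on objects and on pure arrows (preservation of identities
is a consequence). -/
structure KlExtension (H : PartOrd.{u} ⥤ PartOrd.{u}) where
  /-- The action on Kleisli arrows. -/
  map {X Y : PartOrd.{u}} (f : kl Φ X ⟶ kl Φ Y) : kl Φ (H.obj X) ⟶ kl Φ (H.obj Y)
  map_comp {X Y Z : PartOrd.{u}} (f : kl Φ X ⟶ kl Φ Y) (g : kl Φ Y ⟶ kl Φ Z) :
    map (f ≫ g) = map f ≫ map g
  map_pure {X Y : PartOrd.{u}} (f : X ⟶ Y) :
    map (klPure Φ f) = klPure Φ (H.map f)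

/-- The extension as an endofunctor of the Kleisli category. -/
def KlExtension.functor {H : PartOrd.{u} ⥤ PartOrd.{u}} (E : KlExtension Φ H) : Kl Φ ⥤ Kl Φ where
  obj X := kl Φ (H.obj X.of)
  map {X Y} f := E.map (X := X.of) (Y := Y.of) f
  map_id X := by
    have h := E.map_pure (𝟙 X.of)
    rw [H.map_id] at h
    exact h
  map_comp f g := E.map_comp f g

theorem KlExtension.pureFunctor_comp {H : PartOrd.{u} ⥤ PartOrd.{u}} (E : KlExtension Φ H) :
    pureFunctor Φ ⋙ E.functor = H ⋙ pureFunctor Φ :=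
  CategoryTheory.Functor.hext (fun _ => rfl) (fun _ _ f => heq_of_eq (E.map_pure f))

/-- A family of monotone maps with common domain is jointly monic. -/
def JointlyMonic {ι : Type u} {Y : PartOrd.{u}} {Z : ι → PartOrd.{u}} (f : ∀ i, Y ⟶ Z i) : Prop :=
  ∀ (W : PartOrd.{u}) (g h : W ⟶ Y), (∀ i, g ≫ f i = h ≫ f i) → g = h

/-- The pure arrow `X ⇝ X × Φ`, `x ↦ (x, φ)`. -/
def constVersion (φ : Φ) (X : PartOrd.{u}) : kl Φ X ⟶ kl Φ ((prodFunctor Φ).obj X) :=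
  klPure Φ (PartOrd.ofHom (X := X) (Y := X × Φ)
    ⟨fun x => (x, φ), fun _ _ h => ⟨h, le_rfl⟩⟩)

/-- A version filter for an extension `Ĥ`: a family of natural transformations `Ĥ ⟶ Ĥ`,
indexed by the versions (without any monotonicity in the index). -/
structure VersionFilter {H : PartOrd.{u} ⥤ PartOrd.{u}} (E : KlExtension Φ H) where
  /-- The filter for the version `φ`. -/
  filter (φ : Φ) : E.functor ⟶ E.functor
  filter_rho (φ : Φ) (X : PartOrd.{u}) :
    (filter φ).app (kl Φ X) ≫ E.functor.map (constVersion φ X) =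
      (filter φ).app (kl Φ X) ≫ E.functor.map (rho X)
  jointlyMonic (φ : Φ) (X : PartOrd.{u}) :
    JointlyMonic fun ψ : Φ =>
      slice (X := H.obj X) (Y := H.obj X) φ ((filter ψ).app (kl Φ X))

section Coalgebra

variable {H : PartOrd.{u} ⥤ PartOrd.{u}} {E : KlExtension Φ H}

/-- The component `Ĥ X ⇝ Ĥ X` of the filter for the version `φ`. -/
def VersionFilter.at (F : VersionFilter E) (φ : Φ) (X : PartOrd.{u}) :
    kl Φ (H.obj X) ⟶ kl Φ (H.obj X) :=
  (F.filter φ).app (kl Φ X)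

/-- The coalgebra `α : X ⇝ Ĥ X` preserves upgrades. -/
def PreservesUpgrades (F : VersionFilter E) {X : PartOrd.{u}} (α : kl Φ X ⟶ kl Φ (H.obj X)) :
    Prop :=
  (∀ ψ φ : Φ, ψ ≤ φ → slice φ (α ≫ F.at ψ X) = slice ψ (α ≫ F.at ψ X)) ∧
    ∀ ψ φ : Φ, ¬ ψ ≤ φ → ∀ x y : X, slice φ (α ≫ F.at ψ X) x = slice φ (α ≫ F.at ψ X) y

/-- The `H`-coalgebra `X → H X → H X`, `α_φ` followed by the `φ`-slice of the filter for `φ`. -/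
def versionCoalg (F : VersionFilter E) {X : PartOrd.{u}} (α : kl Φ X ⟶ kl Φ (H.obj X)) (φ : Φ) :
    X ⟶ H.obj X :=
  slice φ α ≫ slice φ (F.at φ X)

end Coalgebra

end Reader

/-! ### Quotients of posets, conditional congruences and bisimulations -/

section Quotient

variable (X : PartOrd.{u}) (R : X → X → Prop)

/-- The points of `X`, to be preordered by its order together with `R` and the converse of `R`. -/
def GenPre (X : PartOrd.{u}) (_R : X → X → Prop) : Type u := X

/-- The preorder on `X` generated by its order together with `R` and the converse of `R`. -/
instance : Preorder (GenPre X R) where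
  le := Relation.ReflTransGen fun a b : X => a ≤ b ∨ R a b ∨ R b a
  le_refl _ := Relation.ReflTransGen.refl
  le_trans _ _ _ h k := h.trans k

/-- The quotient `X / R` in posets: the antisymmetrisation of the preorder generated by the order
of `X`, `R` and the converse of `R`. -/
def posetQuot : PartOrd.{u} := PartOrd.of (Antisymmetrization (GenPre X R) (· ≤ ·))

/-- The canonical map `κ : X → X / R`. -/
def quotMap : X ⟶ posetQuot X R :=
  PartOrd.ofHom (X := X) (Y := Antisymmetrization (GenPre X R) (· ≤ ·))
    { toFun := fun x => toAntisymmetrization (α := GenPre X R) (· ≤ ·) x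
      monotone' := fun _ _ h => Relation.ReflTransGen.single (Or.inl h) }

/-- `κ` merges the two projections of `R`. -/
theorem quotMap_eq {x y : X} (h : R x y) : quotMap X R x = quotMap X R y :=
  Quotient.sound (s := AntisymmRel.setoid (GenPre X R) (· ≤ ·))
    ⟨Relation.ReflTransGen.single (Or.inr (Or.inl h)),
      Relation.ReflTransGen.single (Or.inr (Or.inr h))⟩

/-- `κ` is universal among the monotone maps that merge the two projections of `R`. -/
theorem quotMap_universal {Y : PartOrd.{u}} (f : X ⟶ Y) (hf : ∀ x y, R x y → f x = f y) :
    ∃! g : posetQuot X R ⟶ Y, quotMap X R ≫ g = f := by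
  have hle : ∀ a b : X, Relation.ReflTransGen (fun a b : X => a ≤ b ∨ R a b ∨ R b a) a b →
      f a ≤ f b := by
    intro a b h
    induction h with
    | refl => exact le_rfl
    | tail _ h ih =>
      refine le_trans ih ?_
      rcases h with h | h | h
      · exact f.hom.monotone h
      · exact (hf _ _ h).le
      · exact (hf _ _ h).ge
  refine ⟨PartOrd.ofHom (X := Antisymmetrization (GenPre X R) (· ≤ ·)) (Y := Y)
    ⟨fun a => Quotient.liftOn' a (fun x : X => f x)
        fun a b h => le_antisymm (hle a b h.1) (hle b a h.2),
      fun a b => Quotient.inductionOn₂' a b fun a b h => hle a b h⟩, rfl, ?_⟩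
  rintro g rfl
  apply PartOrd.ext
  intro a
  exact Quotient.inductionOn' a fun _ => rfl

end Quotient

section Equivalences

variable {Φ : Type u} [PartialOrder Φ] {H : PartOrd.{u} ⥤ PartOrd.{u}} {E : KlExtension Φ H}

/-- `R` is a bisimulation for the `H`-coalgebra `γ : X → H X`: a relation, that is, a jointly
monic span `p₁, p₂ : P ⇉ X` of posets whose pairs are the ones related by `R`, which carries a
coalgebra structure that makes both projections homomorphisms. -/
def IsBisimulation {X : PartOrd.{u}} (γ : X ⟶ H.obj X) (R : X → X → Prop) : Prop :=
  ∃ (P : PartOrd.{u}) (p₁ p₂ : P ⟶ X) (r : P ⟶ H.obj P),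
    (∀ s t : P, p₁ s = p₁ t → p₂ s = p₂ t → s = t) ∧
    (∀ x y : X, R x y ↔ ∃ s : P, p₁ s = x ∧ p₂ s = y) ∧
    p₁ ≫ γ = r ≫ H.map p₁ ∧ p₂ ≫ γ = r ≫ H.map p₂

/-- A conditional bisimulation for the coalgebra `α : X ⇝ Ĥ X`. -/
def IsCondBisimulation (F : VersionFilter E) {X : PartOrd.{u}} (α : kl Φ X ⟶ kl Φ (H.obj X))
    (R : Φ → X → X → Prop) : Prop :=
  (∀ ψ φ : Φ, ψ ≤ φ → ∀ x y, R φ x y → R ψ x y) ∧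
    ∀ φ, IsBisimulation (versionCoalg F α φ) (R φ)

/-- A conditional congruence for the coalgebra `α : X ⇝ Ĥ X`. -/
def IsCondCongruence (F : VersionFilter E) {X : PartOrd.{u}} (α : kl Φ X ⟶ kl Φ (H.obj X))
    (R : Φ → X → X → Prop) : Prop :=
  (∀ ψ φ : Φ, ψ ≤ φ → ∀ x y, R φ x y → R ψ x y) ∧
    ∀ φ x y, R φ x y →
      (versionCoalg F α φ ≫ H.map (quotMap X (R φ))) x =
        (versionCoalg F α φ ≫ H.map (quotMap X (R φ))) y

/-- `x` and `y` are conditionally bisimilar under `φ`. -/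
def CondBisimilar (F : VersionFilter E) {X : PartOrd.{u}} (α : kl Φ X ⟶ kl Φ (H.obj X))
    (φ : Φ) (x y : X) : Prop :=
  ∃ R, IsCondBisimulation F α R ∧ R φ x y

/-- `x` and `y` are conditionally congruent under `φ`. -/
def CondCongruent (F : VersionFilter E) {X : PartOrd.{u}} (α : kl Φ X ⟶ kl Φ (H.obj X))
    (φ : Φ) (x y : X) : Prop :=
  ∃ R, IsCondCongruence F α R ∧ R φ x y

/-- The commuting square `f₁ ≫ g₁ = f₂ ≫ g₂` is a weak pullback. -/
def IsWeakPullback {P X Y Z : PartOrd.{u}} (f₁ : P ⟶ X) (f₂ : P ⟶ Y) (g₁ : X ⟶ Z) (g₂ : Y ⟶ Z) :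
    Prop :=
  f₁ ≫ g₁ = f₂ ≫ g₂ ∧ ∀ (W : PartOrd.{u}) (h₁ : W ⟶ X) (h₂ : W ⟶ Y), h₁ ≫ g₁ = h₂ ≫ g₂ →
    ∃ d : W ⟶ P, d ≫ f₁ = h₁ ∧ d ≫ f₂ = h₂

/-- `H` preserves weak pullbacks. -/
def PreservesWeakPullbacks (H : PartOrd.{u} ⥤ PartOrd.{u}) : Prop :=
  ∀ (P X Y Z : PartOrd.{u}) (f₁ : P ⟶ X) (f₂ : P ⟶ Y) (g₁ : X ⟶ Z) (g₂ : Y ⟶ Z),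
    IsWeakPullback f₁ f₂ g₁ g₂ → IsWeakPullback (H.map f₁) (H.map f₂) (H.map g₁) (H.map g₂)

/-- `H` preserves the class of order preserving injections. -/
def PreservesInjections (H : PartOrd.{u} ⥤ PartOrd.{u}) : Prop :=
  ∀ (X Y : PartOrd.{u}) (m : X ⟶ Y), Function.Injective m → Function.Injective (H.map m)

end Equivalences

/-! ### The final chain minimisation algorithm -/

section Algorithm

variable {Φ : Type u} [PartialOrder Φ] {H : PartOrd.{u} ⥤ PartOrd.{u}}

/-- `f = m ∘ e` is a pseudo-factorisation: the reflection `X × Φ → Y` of `f` factorises as a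
regular epimorphism `e'` followed by the order preserving injection `m`, and `e = e' ∘ ρ_X`. -/
def IsPseudoFactorisation {X Y Z : PartOrd.{u}} (f : kl Φ X ⟶ kl Φ Y) (e : kl Φ X ⟶ kl Φ Z)
    (m : Z ⟶ Y) : Prop :=
  ∃ e' : (prodFunctor Φ).obj X ⟶ Z, IsRegularEpi e' ∧ Function.Injective m ∧
    uncurry f = e' ≫ m ∧ e = rho X ≫ klPure Φ e'

/-- `Stage E α i e`: the arrow `e : X ⇝ Z` is a possible value of `e_i` in a run of the algorithm
on the coalgebra `α : X ⇝ Ĥ X`. Here `d_0` is the final arrow `X ⇝ 1`, `d_{i+1} = Ĥ e_i ∘ α`, and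
`d_i = m_i ∘ e_i` is any pseudo-factorisation. -/
inductive Stage (E : KlExtension Φ H) {X : PartOrd.{u}} (α : kl Φ X ⟶ kl Φ (H.obj X)) :
    ℕ → ∀ {Z : PartOrd.{u}}, (kl Φ X ⟶ kl Φ Z) → Prop
  | zero {Z : PartOrd.{u}} {e : kl Φ X ⟶ kl Φ Z} {m : Z ⟶ PartOrd.of PUnit.{u + 1}} :
      IsPseudoFactorisation (toOne Φ X) e m → Stage E α 0 e
  | succ {i : ℕ} {Z Z' : PartOrd.{u}} {e : kl Φ X ⟶ kl Φ Z} {e' : kl Φ X ⟶ kl Φ Z'}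
      {m : Z' ⟶ H.obj Z} :
      Stage E α i e → IsPseudoFactorisation (α ≫ E.map e) e' m → Stage E α (i + 1) e'

/-- The algorithm, run on `α`, terminates at stage `n` with output `e_n = e`: there is an
isomorphism of posets `u : Z_{n+1} ≅ Z_n` with `e_n = u ∘ e_{n+1}`. -/
def IsOutput (E : KlExtension Φ H) {X Z : PartOrd.{u}} (α : kl Φ X ⟶ kl Φ (H.obj X)) (n : ℕ)
    (e : kl Φ X ⟶ kl Φ Z) : Prop :=
  Stage E α n e ∧ ∃ (Z' : PartOrd.{u}) (e' : kl Φ X ⟶ kl Φ Z') (m : Z' ⟶ H.obj Z) (u : Z' ≅ Z),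
    IsPseudoFactorisation (α ≫ E.map e) e' m ∧ e = e' ≫ klPure Φ u.hom

end Algorithm

/-! ### Conditional transition systems and their functors -/

section CTS

/-- The powerset functor on posets: all subsets ordered by inclusion, with direct images. -/
def powFunctor : PartOrd.{u} ⥤ PartOrd.{u} where
  obj X := PartOrd.of (Set X)
  map {X Y} f := PartOrd.ofHom (X := Set X) (Y := Set Y)
    ⟨fun S => f '' S, fun _ _ h => Set.image_mono h⟩
  map_id _ := PartOrd.ext fun S => Set.image_id S
  map_comp f g := PartOrd.ext fun S => Set.image_comp g f S

/-- The functor `X ↦ X^A` on posets, for a set (discrete poset) `A`. -/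
def expFunctor (A : Type u) : PartOrd.{u} ⥤ PartOrd.{u} where
  obj X := PartOrd.of (A → X)
  map {X Y} f := PartOrd.ofHom (X := A → X) (Y := A → Y)
    ⟨fun p a => f (p a), fun _ _ h a => f.hom.monotone (h a)⟩
  map_id _ := rfl
  map_comp _ _ := rfl

/-- The functor `X ↦ P(X)^A`. -/
abbrev ctsFunctor (A : Type u) : PartOrd.{u} ⥤ PartOrd.{u} :=
  powFunctor ⋙ expFunctor A

/-- The functor `X ↦ (D P X)^A`, subsets ordered by reverse inclusion. -/
abbrev ctsDualFunctor (A : Type u) : PartOrd.{u} ⥤ PartOrd.{u} :=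
  powFunctor ⋙ PartOrd.dual ⋙ expFunctor A

/-- The functor `X ↦ P(X × Φ)^A`. -/
abbrev ctsUpgradeFunctor (A Φ : Type u) [PartialOrder Φ] : PartOrd.{u} ⥤ PartOrd.{u} :=
  prodFunctor Φ ⋙ powFunctor ⋙ expFunctor A

/-- A set regarded as a discrete poset. -/
def discr (X : Type u) : PartOrd.{u} :=
  @PartOrd.of X
    { le := fun x y => x = y
      le_refl := fun _ => rfl
      le_trans := fun _ _ _ h k => h.trans k
      le_antisymm := fun _ _ h _ => h }

variable {Φ A X : Type u} [PartialOrder Φ]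

/-- The transition function of a conditional transition system with states `X`, actions `A` and
conditions `Φ`: each `f x a` is a monotone map from `Φ` to the subsets of `X` ordered by reverse
inclusion. -/
abbrev CTS (Φ A X : Type u) [PartialOrder Φ] := X → A → (Φ →o (Set X)ᵒᵈ)

/-- The set of states reached from `x` by `a` under the condition `φ`. -/
def CTS.next (f : CTS Φ A X) (x : X) (a : A) (φ : Φ) : Set X := OrderDual.ofDual (f x a φ)

/-- A conditional bisimulation on a CTS: a family of bisimulations, one for the labelled
transition system of each condition, which grows along upgrades. -/
def CTS.IsCondBisimulation (f : CTS Φ A X) (R : Φ → X → X → Prop) : Prop :=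
  (∀ φ x y, R φ x y → ∀ a,
    (∀ x' ∈ f.next x a φ, ∃ y' ∈ f.next y a φ, R φ x' y') ∧
    (∀ y' ∈ f.next y a φ, ∃ x' ∈ f.next x a φ, R φ x' y')) ∧
  ∀ ψ φ, ψ ≤ φ → ∀ x y, R φ x y → R ψ x y

/-- `x ∼_φ y` in a CTS. -/
def CTS.Bisimilar (f : CTS Φ A X) (φ : Φ) (x y : X) : Prop :=
  ∃ R, f.IsCondBisimulation R ∧ R φ x y

/-- The reflector from the Kleisli category to posets, `f ↦ ((x, φ) ↦ (f x φ, φ))`. -/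
def reflector {Y Z : PartOrd.{u}} (f : kl Φ Y ⟶ kl Φ Z) :
    (prodFunctor Φ).obj Y ⟶ (prodFunctor Φ).obj Z :=
  PartOrd.ofHom (X := Y × Φ) (Y := Z × Φ)
    ⟨fun p => (uncurry f p, p.2), fun _ _ h => ⟨(uncurry f).hom.monotone h, h.2⟩⟩

variable (A Φ) in
/-- The extension of `P(- × Φ)^A`, given by
`Ĥ f p φ a = {(f x φ', φ') | (x, φ') ∈ p a}`. -/
def ctsUpgradeExtension : KlExtension Φ (ctsUpgradeFunctor A Φ) where
  map {Y Z} f := klPure Φ (X := (ctsUpgradeFunctor A Φ).obj Y) (Y := (ctsUpgradeFunctor A Φ).obj Z)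
    ((ctsFunctor A).map (reflector f))
  map_comp f g := by
    have h : reflector (f ≫ g) = reflector f ≫ reflector g := rfl
    rw [h, CategoryTheory.Functor.map_comp]
    rfl
  map_pure _ := rfl

theorem ctsUpgradeExtension_apply {Y Z : PartOrd.{u}} (f : kl Φ Y ⟶ kl Φ Z)
    (p : A → Set (Y × Φ)) (φ : Φ) (a : A) :
    (klFun ((ctsUpgradeExtension Φ A).map f) p φ : A → Set (Z × Φ)) a =
      {z | ∃ x φ', (x, φ') ∈ p a ∧ (klFun f x φ', φ') = z} := by
  apply Set.ext
  intro z
  constructor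
  · rintro ⟨⟨x, φ'⟩, h, rfl⟩
    exact ⟨x, φ', h, rfl⟩
  · rintro ⟨x, φ', h, rfl⟩
    exact ⟨⟨x, φ'⟩, h, rfl⟩

/-- For a discrete order of conditions, the extension of an endofunctor `H` given by
`Ĥ f h φ = H f_φ h`; on `P` this is `Ĥ f C φ = {f x φ | x ∈ C}`. -/
def discreteExtension (hΦ : ∀ φ ψ : Φ, φ ≤ ψ → φ = ψ) (H : PartOrd.{u} ⥤ PartOrd.{u}) :
    KlExtension Φ H where
  map {Y Z} f := klMk (X := H.obj Y) (Y := H.obj Z)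
    ⟨fun h => ⟨fun φ => H.map (slice φ f) h, fun φ ψ hle => by rw [hΦ φ ψ hle]⟩,
      fun _ _ hle φ => (H.map (slice φ f)).hom.monotone hle⟩
  map_comp f g := by
    apply kl_ext
    intro h φ
    have hs : slice φ (f ≫ g) = slice φ f ≫ slice φ g := rfl
    change H.map (slice φ (f ≫ g)) h = H.map (slice φ g) (H.map (slice φ f) h)
    rw [hs, Functor.map_comp]
    rfl
  map_pure _ := rfl

/-- The version filter for `P(- × Φ)^A`: the filter for `φ` keeps the pairs with version `φ`. -/
def ctsUpgradeFilter : VersionFilter (ctsUpgradeExtension Φ A) where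
  filter φ :=
    { app := fun Y => klPure Φ
        (PartOrd.ofHom (X := A → Set (Y.of × Φ)) (Y := A → Set (Y.of × Φ))
          ⟨fun p a => {z | z ∈ p a ∧ z.2 = φ}, fun _ _ h a _ hz => ⟨h a hz.1, hz.2⟩⟩)
      naturality := fun Y Z f => by
        apply kl_ext (X := (ctsUpgradeFunctor A Φ).obj Y.of)
          (Y := (ctsUpgradeFunctor A Φ).obj Z.of)
        intro p ψ
        funext a
        apply Set.ext
        intro z
        constructor
        · rintro ⟨⟨w, hw, rfl⟩, h⟩
          exact ⟨w, ⟨hw, h⟩, rfl⟩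
        · rintro ⟨w, ⟨hw, h⟩, rfl⟩
          exact ⟨⟨w, hw, rfl⟩, h⟩ }
  filter_rho φ Y := by
    apply kl_ext (X := (ctsUpgradeFunctor A Φ).obj Y)
      (Y := (ctsUpgradeFunctor A Φ).obj ((prodFunctor Φ).obj Y))
    intro p ψ
    funext a
    apply Set.ext
    intro z
    constructor
    · rintro ⟨⟨y, χ⟩, ⟨hw, h⟩, rfl⟩
      obtain rfl : χ = φ := h
      exact ⟨⟨y, χ⟩, ⟨hw, rfl⟩, rfl⟩
    · rintro ⟨⟨y, χ⟩, ⟨hw, h⟩, rfl⟩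
      obtain rfl : χ = φ := h
      exact ⟨⟨y, χ⟩, ⟨hw, rfl⟩, rfl⟩
  jointlyMonic φ Y W g h hgh := by
    apply PartOrd.ext
    intro w
    funext a
    apply Set.ext
    intro z
    have key := congrArg
      (fun k : W ⟶ (ctsUpgradeFunctor A Φ).obj Y => (k w : A → Set (Y × Φ)) a) (hgh z.2)
    have hz := Set.ext_iff.mp key z
    exact ⟨fun hg => (hz.mp ⟨hg, rfl⟩).1, fun hh => (hz.mpr ⟨hh, rfl⟩).1⟩

open Classical in
/-- For a discrete order of conditions and a functor `H` with a naturally chosen element `z` of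
each `H Y`: the version filter `C ↦ (ψ ↦ C if ψ = φ, and z otherwise)`. -/
noncomputable def discreteFilter (hΦ : ∀ φ ψ : Φ, φ ≤ ψ → φ = ψ) (H : PartOrd.{u} ⥤ PartOrd.{u})
    (z : ∀ Y : PartOrd.{u}, H.obj Y) (hz : ∀ (Y Z : PartOrd.{u}) (f : Y ⟶ Z), H.map f (z Y) = z Z) :
    VersionFilter (discreteExtension hΦ H) where
  filter φ :=
    { app := fun Y => klMk (X := H.obj Y.of) (Y := H.obj Y.of)
        ⟨fun C => ⟨fun ψ => if ψ = φ then C else z Y.of,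
            fun ψ χ hle => by rw [hΦ ψ χ hle]⟩,
          fun C D hle ψ => by
            change (if ψ = φ then C else z Y.of) ≤ (if ψ = φ then D else z Y.of)
            split_ifs
            · exact hle
            · exact le_rfl⟩
      naturality := fun Y Z f => by
        apply kl_ext (X := H.obj Y.of) (Y := H.obj Z.of)
        intro C ψ
        change (if ψ = φ then H.map (slice (X := Y.of) (Y := Z.of) ψ f) C else z Z.of) =
          H.map (slice (X := Y.of) (Y := Z.of) ψ f) (if ψ = φ then C else z Y.of)
        split_ifs
        · rfl
        · exact (hz _ _ _).symm }
  filter_rho φ Y := by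
    apply kl_ext (X := H.obj Y) (Y := H.obj ((prodFunctor Φ).obj Y))
    intro C ψ
    change H.map (slice ψ (constVersion φ Y)) (if ψ = φ then C else z Y) =
      H.map (slice ψ (rho Y)) (if ψ = φ then C else z Y)
    split_ifs with h
    · subst h
      rfl
    · rw [hz, hz]
  jointlyMonic φ Y W g h hgh := by
    apply PartOrd.ext
    intro w
    have key := congrArg (fun k : W ⟶ H.obj Y => k w) (hgh φ)
    change (if φ = φ then g w else z Y) = (if φ = φ then h w else z Y) at key
    rwa [if_pos rfl, if_pos rfl] at key

/-- The version filter for `P(-)^A` (discrete order of conditions), with default value `∅`. -/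
noncomputable def ctsFilter (hΦ : ∀ φ ψ : Φ, φ ≤ ψ → φ = ψ) :
    VersionFilter (discreteExtension hΦ (ctsFunctor A)) :=
  discreteFilter hΦ (ctsFunctor A) (fun Y => fun _ => (∅ : Set Y))
    (fun _ _ f => funext fun _ => Set.image_empty f)

/-- The version filter for `(D P -)^A` (discrete order of conditions), with default value `∅`. -/
noncomputable def ctsDualFilter (hΦ : ∀ φ ψ : Φ, φ ≤ ψ → φ = ψ) :
    VersionFilter (discreteExtension hΦ (ctsDualFunctor A)) :=
  discreteFilter hΦ (ctsDualFunctor A) (fun Y => fun _ => OrderDual.toDual (∅ : Set Y))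
    (fun _ _ f => funext fun _ => congrArg OrderDual.toDual (Set.image_empty f))

/-- The coalgebra of a CTS for `P(- × Φ)^A`:
`α x φ a = {(x', φ') | x' ∈ f x a φ' and φ' ≤ φ}`. -/
def CTS.upgradeCoalg (f : CTS Φ A X) :
    kl Φ (discr X) ⟶ kl Φ ((ctsUpgradeFunctor A Φ).obj (discr X)) :=
  klMk (X := discr X) (Y := (ctsUpgradeFunctor A Φ).obj (discr X))
    ⟨fun x => ⟨fun φ a => {z : X × Φ | z.1 ∈ f.next x a z.2 ∧ z.2 ≤ φ},
        fun _ _ h _ _ hz => ⟨hz.1, le_trans hz.2 h⟩⟩,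
      fun x y h => by
        obtain rfl : x = y := h
        exact le_rfl⟩

/-- The coalgebra of a CTS for `P(-)^A` (discrete order of conditions): `α x φ a = f x a φ`. -/
def CTS.coalg (hΦ : ∀ φ ψ : Φ, φ ≤ ψ → φ = ψ) (f : CTS Φ A X) :
    kl Φ (discr X) ⟶ kl Φ ((ctsFunctor A).obj (discr X)) :=
  klMk (X := discr X) (Y := (ctsFunctor A).obj (discr X))
    ⟨fun x => ⟨fun φ a => f.next x a φ, fun φ ψ h => by rw [hΦ φ ψ h]; exact le_rfl⟩,
      fun x y h => by
        obtain rfl : x = y := h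
        exact le_rfl⟩

/-- The coalgebra of a CTS for `(D P -)^A`: `α x φ a = f x a φ`. -/
def CTS.dualCoalg (f : CTS Φ A X) :
    kl Φ (discr X) ⟶ kl Φ ((ctsDualFunctor A).obj (discr X)) :=
  klMk (X := discr X) (Y := (ctsDualFunctor A).obj (discr X))
    ⟨fun x => ⟨fun φ a => f x a φ, fun _ _ h a => (f x a).monotone h⟩,
      fun x y h => by
        obtain rfl : x = y := h
        exact le_rfl⟩

end CTS

end CondTS

/-! Everything is a comparison of kernels. A Kleisli arrow `e` is its uncurrying after `rho`, and a
filter for `χ` cannot tell `rho` from the constant arrow at `χ`; hence after filtering for `χ`, `Ĥ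
e` acts as the pure map `H e_χ` (`VersionFilter.at_comp_map`). With naturality, filtering `Ĥ e ∘ α`
for `χ` gives `H e_χ` applied to the filtered `α`. The filters are jointly monic in each slice, and
preservation of upgrades turns the filtered `α` at `φ` into `γ_χ` if `χ ≤ φ` and into a constant
otherwise. So `Ĥ e ∘ α` identifies `x` and `y` at `φ` exactly if `H e_χ ∘ γ_χ` identifies them for
all `χ ≤ φ` (`PreservesUpgrades.slice_eq`, `PreservesUpgrades.map_versionCoalg_eq`).

Pseudo-factorising does not change kernels, as `m` is injective. By induction, every stage therefore
merges every conditional congruence. At termination the criterion holds with the kernels of `e_n` on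
both sides. These kernels thus grow along upgrades, since a smaller `φ` means fewer conditions, and
`H (e_n)_φ ∘ γ_φ` merges the kernel at `φ`. If `H` preserves injections, then `H κ_φ` merges it too,
for `X / ker` injects into `Z_n`: the kernels form a conditional congruence. If `H` preserves weak
pullbacks, the kernel pairs carry coalgebra structures and the kernels form a conditional
bisimulation.

For transition systems it is enough to place the concrete notion between the two coalgebraic ones:
coalgebraic conditional bisimulations are bisimulations of the CTS, and these are conditional
congruences. The output has the same kernels for both extremes (`IsOutput.cts_bisimilar_iff`). -/

namespace CondTS

/-! ### Version filters and preservation of upgrades -/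

section General

variable {Φ : Type u} [PartialOrder Φ] {H : PartOrd.{u} ⥤ PartOrd.{u}} {E : KlExtension Φ H}

/-- After filtering for the version `φ`, the extension of a Kleisli arrow acts as its `φ`-slice. -/
theorem VersionFilter.at_comp_map (F : VersionFilter E) {X Z : PartOrd.{u}}
    (e : kl Φ X ⟶ kl Φ Z) (φ : Φ) :
    F.at φ X ≫ E.map e = F.at φ X ≫ klPure Φ (H.map (slice φ e)) := by
  -- The factorisation of `e` through `rho X` makes `filter_rho` applicable; replacing `rho X` by
  -- the constant arrow then leaves the pure arrow `e_φ`.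
  have hρ : E.map e = E.map (rho X) ≫ E.map (klPure Φ (uncurry e)) := by
    rw [← E.map_comp, (rho_universal e (uncurry e)).mpr rfl]
  have hc : klPure Φ (slice φ e) = constVersion φ X ≫ klPure Φ (uncurry e) := rfl
  have hf : F.at φ X ≫ E.map (constVersion φ X) = F.at φ X ≫ E.map (rho X) := F.filter_rho φ X
  rw [hρ, ← Category.assoc, ← hf, Category.assoc, ← E.map_comp, ← hc, E.map_pure]

theorem VersionFilter.naturality (F : VersionFilter E) {X Z : PartOrd.{u}}
    (e : kl Φ X ⟶ kl Φ Z) (φ : Φ) : E.map e ≫ F.at φ Z = F.at φ X ≫ E.map e :=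
  (F.filter φ).naturality e

/-- Filtering `Ĥ e ∘ α` for the version `χ` amounts to applying `H e_χ` to the filtered `α`. -/
theorem VersionFilter.slice_at_comp_map (F : VersionFilter E) {X Z : PartOrd.{u}}
    (α : kl Φ X ⟶ kl Φ (H.obj X)) (e : kl Φ X ⟶ kl Φ Z) (χ φ : Φ) (x : X) :
    slice φ (F.at χ Z) (slice φ (α ≫ E.map e) x) =
      H.map (slice χ e) (slice φ (α ≫ F.at χ X) x) := by
  have h : (α ≫ E.map e) ≫ F.at χ Z = (α ≫ F.at χ X) ≫ klPure Φ (H.map (slice χ e)) := by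
    rw [Category.assoc, F.naturality, F.at_comp_map, Category.assoc]
  exact congrArg (fun k : kl Φ X ⟶ kl Φ (H.obj Z) => slice φ k x) h

/-- Elements are separated by the filters. -/
theorem VersionFilter.eq_of_slice_at_eq (F : VersionFilter E) {Z : PartOrd.{u}} (φ : Φ)
    {a b : H.obj Z} (h : ∀ χ, slice φ (F.at χ Z) a = slice φ (F.at χ Z) b) : a = b := by
  -- Elements are maps out of the one-point poset, so joint monicity separates points.
  have key := F.jointlyMonic φ Z (PartOrd.of PUnit.{u + 1})
    (PartOrd.ofHom (X := PUnit.{u + 1}) (Y := H.obj Z) (OrderHom.const _ a))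
    (PartOrd.ofHom (X := PUnit.{u + 1}) (Y := H.obj Z) (OrderHom.const _ b))
    (fun χ => PartOrd.ext fun _ => h χ)
  exact congrArg (fun k : PartOrd.of PUnit.{u + 1} ⟶ H.obj Z => k PUnit.unit) key

/-- For a coalgebra that preserves upgrades, two values of `Ĥ e ∘ α` at `φ` coincide as soon as
they do on all filtered versions below `φ`. -/
theorem PreservesUpgrades.slice_eq (F : VersionFilter E) {X Z : PartOrd.{u}}
    {α : kl Φ X ⟶ kl Φ (H.obj X)} (hα : PreservesUpgrades F α) (e : kl Φ X ⟶ kl Φ Z) {φ : Φ}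
    {x y : X} (h : ∀ χ ≤ φ, H.map (slice χ e) (versionCoalg F α χ x) =
      H.map (slice χ e) (versionCoalg F α χ y)) :
    slice φ (α ≫ E.map e) x = slice φ (α ≫ E.map e) y := by
  refine F.eq_of_slice_at_eq φ fun χ => ?_
  rw [F.slice_at_comp_map, F.slice_at_comp_map]
  -- Versions below `φ` are covered by `h`; for the others the filtered `α` does not depend on the
  -- state.
  by_cases hχ : χ ≤ φ
  · rw [hα.1 χ φ hχ]
    exact h χ hχ
  · rw [hα.2 χ φ hχ x y]

/-- Conversely, the value of `Ĥ e ∘ α` at `φ` determines the filtered versions below `φ`. -/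
theorem PreservesUpgrades.map_versionCoalg_eq (F : VersionFilter E) {X Z : PartOrd.{u}}
    {α : kl Φ X ⟶ kl Φ (H.obj X)} (hα : PreservesUpgrades F α) (e : kl Φ X ⟶ kl Φ Z) {φ : Φ}
    {x y : X} (h : slice φ (α ≫ E.map e) x = slice φ (α ≫ E.map e) y) {χ : Φ} (hχ : χ ≤ φ) :
    H.map (slice χ e) (versionCoalg F α χ x) = H.map (slice χ e) (versionCoalg F α χ y) := by
  have hx := F.slice_at_comp_map α e χ φ x
  have hy := F.slice_at_comp_map α e χ φ y
  -- The `χ`-slice of `α ≫ F.at χ X` is `versionCoalg F α χ` by definition.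
  rw [hα.1 χ φ hχ] at hx hy
  exact hx.symm.trans ((congrArg (slice φ (F.at χ Z)) h).trans hy)

/-! ### Quotients and kernels under `H` -/

/-- If `f` merges the pairs of `R`, then `H f` merges what `H κ` merges. -/
theorem map_eq_of_map_quotMap_eq (H : PartOrd.{u} ⥤ PartOrd.{u}) {X Z : PartOrd.{u}}
    {R : X → X → Prop} (f : X ⟶ Z) (hf : ∀ x y, R x y → f x = f y) {a b : H.obj X}
    (h : H.map (quotMap X R) a = H.map (quotMap X R) b) : H.map f a = H.map f b := by
  obtain ⟨g, rfl, -⟩ := quotMap_universal X R f hf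
  rw [H.map_comp]
  exact congrArg (H.map g) h

/-- If `H` preserves injections, then `H κ` merges what `H f` merges, for the quotient by the
kernel of `f`. -/
theorem PreservesInjections.map_quotMap_ker_eq (hH : PreservesInjections H) {X Z : PartOrd.{u}}
    (f : X ⟶ Z) {a b : H.obj X} (h : H.map f a = H.map f b) :
    H.map (quotMap X fun x y => f x = f y) a = H.map (quotMap X fun x y => f x = f y) b := by
  obtain ⟨g, hg, -⟩ := quotMap_universal X (fun x y => f x = f y) f fun _ _ => id
  have hg' : ∀ x, g (quotMap X (fun x y => f x = f y) x) = f x := fun x =>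
    congrArg (fun k : X ⟶ Z => k x) hg
  -- The induced map need not reflect the order, so injections rather than order embeddings have to
  -- be preserved.
  have hinj : Function.Injective g := by
    intro p q
    refine Quotient.inductionOn₂' p q fun x y hxy => quotMap_eq X _ ?_
    exact (hg' x).symm.trans (hxy.trans (hg' y))
  apply hH _ _ g hinj
  have hmap : H.map (quotMap X fun x y => f x = f y) ≫ H.map g = H.map f := by
    rw [← H.map_comp, hg]
  exact (congrArg (fun k : H.obj X ⟶ H.obj Z => k a) hmap).trans
    (h.trans (congrArg (fun k : H.obj X ⟶ H.obj Z => k b) hmap).symm)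

/-! ### Kernels along the algorithm; congruence and bisimilarity -/

theorem IsPseudoFactorisation.slice_eq {X Y Z : PartOrd.{u}} {f : kl Φ X ⟶ kl Φ Y}
    {e : kl Φ X ⟶ kl Φ Z} {m : Z ⟶ Y} (h : IsPseudoFactorisation f e m) (φ : Φ) :
    slice φ f = slice φ e ≫ m := by
  obtain ⟨e', -, -, hf, rfl⟩ := h
  exact PartOrd.ext fun x =>
    congrArg (fun k : (prodFunctor Φ).obj X ⟶ Y => k ((x, φ) : X × Φ)) hf

theorem IsPseudoFactorisation.slice_apply_eq_iff {X Y Z : PartOrd.{u}} {f : kl Φ X ⟶ kl Φ Y}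
    {e : kl Φ X ⟶ kl Φ Z} {m : Z ⟶ Y} (h : IsPseudoFactorisation f e m) (φ : Φ) (x y : X) :
    slice φ e x = slice φ e y ↔ slice φ f x = slice φ f y := by
  have hm : Function.Injective m := by
    obtain ⟨-, -, hm, -⟩ := h
    exact hm
  rw [h.slice_eq φ]
  exact hm.eq_iff.symm

/-- Every stage of the algorithm merges conditionally congruent states. -/
theorem Stage.slice_eq_of_isCondCongruence (F : VersionFilter E) {X : PartOrd.{u}}
    {α : kl Φ X ⟶ kl Φ (H.obj X)} (hα : PreservesUpgrades F α) {R : Φ → X → X → Prop}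
    (hR : IsCondCongruence F α R) {n : ℕ} {Z : PartOrd.{u}} {e : kl Φ X ⟶ kl Φ Z}
    (he : Stage E α n e) : ∀ φ x y, R φ x y → slice φ e x = slice φ e y := by
  induction he with
  | zero hp => exact fun φ x y _ => (hp.slice_apply_eq_iff φ x y).mpr rfl
  | succ _ hp ih =>
    intro φ x y h
    -- The value at `φ` involves every `χ ≤ φ`, which is where the growth of `R` along upgrades
    -- enters; the induction hypothesis at `χ` makes `e_χ` factor through `X / R χ`.
    refine (hp.slice_apply_eq_iff φ x y).mpr (hα.slice_eq F _ fun χ hχ => ?_)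
    exact map_eq_of_map_quotMap_eq H _ (ih χ) (hR.2 χ x y (hR.1 χ φ hχ x y h))

/-- The kernel of the output is that of the next arrow of the final chain. -/
theorem IsOutput.slice_eq_iff {X Z : PartOrd.{u}} {α : kl Φ X ⟶ kl Φ (H.obj X)} {n : ℕ}
    {e : kl Φ X ⟶ kl Φ Z} (he : IsOutput E α n e) (φ : Φ) (x y : X) :
    slice φ e x = slice φ e y ↔ slice φ (α ≫ E.map e) x = slice φ (α ≫ E.map e) y := by
  obtain ⟨-, Z', e', m, v, hp, hu⟩ := he
  rw [← hp.slice_apply_eq_iff φ x y]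
  have h : slice φ e = slice φ e' ≫ v.hom := by
    conv_lhs => rw [hu]
    rfl
  have hv : Function.Injective v.hom := by
    intro p q hpq
    have h₁ : ∀ p, v.inv (v.hom p) = p := fun p =>
      congrArg (fun k : Z' ⟶ Z' => k p) v.hom_inv_id
    rw [← h₁ p, hpq, h₁ q]
  rw [h]
  exact hv.eq_iff

/-- The kernels of the slices of the output grow along upgrades. -/
theorem IsOutput.slice_eq_of_le (F : VersionFilter E) {X Z : PartOrd.{u}}
    {α : kl Φ X ⟶ kl Φ (H.obj X)} (hα : PreservesUpgrades F α) {n : ℕ} {e : kl Φ X ⟶ kl Φ Z}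
    (he : IsOutput E α n e) {ψ φ : Φ} (hle : ψ ≤ φ) {x y : X}
    (h : slice φ e x = slice φ e y) : slice ψ e x = slice ψ e y := by
  -- Passing to the next arrow makes the growth visible: its kernel at `ψ` is cut out by the
  -- versions `χ ≤ ψ`, all of which lie below `φ`.
  rw [he.slice_eq_iff] at h ⊢
  exact hα.slice_eq F e fun χ hχ => hα.map_versionCoalg_eq F e h (hχ.trans hle)

/-- This is the instance `χ = φ` of the criterion, read at the fixed point; it is what makes the
kernels of the output compatible with the coalgebras. -/
theorem IsOutput.map_versionCoalg_eq (F : VersionFilter E) {X Z : PartOrd.{u}}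
    {α : kl Φ X ⟶ kl Φ (H.obj X)} (hα : PreservesUpgrades F α) {n : ℕ} {e : kl Φ X ⟶ kl Φ Z}
    (he : IsOutput E α n e) {φ : Φ} {x y : X} (h : slice φ e x = slice φ e y) :
    H.map (slice φ e) (versionCoalg F α φ x) = H.map (slice φ e) (versionCoalg F α φ y) :=
  hα.map_versionCoalg_eq F e ((he.slice_eq_iff φ x y).mp h) le_rfl

/-- The output of the algorithm characterises conditional congruence. -/
theorem IsOutput.condCongruent_iff (F : VersionFilter E) (hH : PreservesInjections H)
    {X Z : PartOrd.{u}} {α : kl Φ X ⟶ kl Φ (H.obj X)} (hα : PreservesUpgrades F α) {n : ℕ}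
    {e : kl Φ X ⟶ kl Φ Z} (he : IsOutput E α n e) (φ : Φ) (x y : X) :
    CondCongruent F α φ x y ↔ slice φ e x = slice φ e y := by
  constructor
  · rintro ⟨R, hR, h⟩
    exact he.1.slice_eq_of_isCondCongruence F hα hR φ x y h
  · intro h
    refine ⟨fun φ x y => slice φ e x = slice φ e y, ⟨?_, ?_⟩, h⟩
    · exact fun ψ φ hle x y h => he.slice_eq_of_le F hα hle h
    · exact fun φ x y h => hH.map_quotMap_ker_eq (slice φ e) (he.map_versionCoalg_eq F hα h)

/-- Since `κ` coequalises `p₁` and `p₂`, so does `H κ ∘ γ`: both composites equal `H (κ ∘ p_i) ∘ r`.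
No property of `H` beyond functoriality is involved. -/
theorem IsCondBisimulation.isCondCongruence {F : VersionFilter E} {X : PartOrd.{u}}
    {α : kl Φ X ⟶ kl Φ (H.obj X)} {R : Φ → X → X → Prop} (hR : IsCondBisimulation F α R) :
    IsCondCongruence F α R := by
  refine ⟨hR.1, fun φ x y h => ?_⟩
  obtain ⟨P, p₁, p₂, r, -, hP, h₁, h₂⟩ := hR.2 φ
  obtain ⟨s, rfl, rfl⟩ := (hP x y).mp h
  have hq : p₁ ≫ quotMap X (R φ) = p₂ ≫ quotMap X (R φ) :=
    PartOrd.ext fun t => quotMap_eq X _ ((hP _ _).mpr ⟨t, rfl, rfl⟩)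
  have key : p₁ ≫ versionCoalg F α φ ≫ H.map (quotMap X (R φ)) =
      p₂ ≫ versionCoalg F α φ ≫ H.map (quotMap X (R φ)) := by
    rw [← Category.assoc, ← Category.assoc, h₁, h₂, Category.assoc, Category.assoc,
      ← H.map_comp, ← H.map_comp, hq]
  exact congrArg (fun k : P ⟶ H.obj (posetQuot X (R φ)) => k s) key

/-- If `H` preserves weak pullbacks, then the kernel of `f` is a bisimulation for `γ` whenever
`H f ∘ γ` merges it. -/
theorem PreservesWeakPullbacks.isBisimulation_ker (hH : PreservesWeakPullbacks H)
    {X Z : PartOrd.{u}} (γ : X ⟶ H.obj X) (f : X ⟶ Z)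
    (hf : ∀ x y, f x = f y → H.map f (γ x) = H.map f (γ y)) :
    IsBisimulation γ fun x y => f x = f y := by
  -- The kernel pair of `f` with the order of `X × X` is a genuine pullback, hence a weak one; the
  -- coalgebra structure is a mediating map into its image under `H`.
  let P : PartOrd.{u} := PartOrd.of {p : X × X // f p.1 = f p.2}
  let p₁ : P ⟶ X := PartOrd.ofHom (X := {p : X × X // f p.1 = f p.2}) (Y := X)
    ⟨fun p => p.1.1, fun _ _ h => h.1⟩
  let p₂ : P ⟶ X := PartOrd.ofHom (X := {p : X × X // f p.1 = f p.2}) (Y := X)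
    ⟨fun p => p.1.2, fun _ _ h => h.2⟩
  have hw : IsWeakPullback p₁ p₂ f f := by
    refine ⟨PartOrd.ext fun p => p.2, fun W h₁ h₂ h => ?_⟩
    exact ⟨PartOrd.ofHom (X := W) (Y := {p : X × X // f p.1 = f p.2})
      ⟨fun w => ⟨(h₁ w, h₂ w), congrArg (fun k : W ⟶ Z => k w) h⟩,
        fun _ _ h => ⟨h₁.hom.monotone h, h₂.hom.monotone h⟩⟩, rfl, rfl⟩
  obtain ⟨r, hr₁, hr₂⟩ := (hH _ _ _ _ _ _ _ _ hw).2 P (p₁ ≫ γ) (p₂ ≫ γ)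
    (PartOrd.ext fun p => hf _ _ p.2)
  refine ⟨P, p₁, p₂, r, fun s t h₁ h₂ => Subtype.ext (Prod.ext h₁ h₂), fun x y => ?_,
    hr₁.symm, hr₂.symm⟩
  constructor
  · exact fun h => ⟨⟨(x, y), h⟩, rfl, rfl⟩
  · rintro ⟨s, rfl, rfl⟩
    exact s.2

/-- The kernels of the slices of the output form a conditional bisimulation. -/
theorem IsOutput.isCondBisimulation_ker (F : VersionFilter E) (hH : PreservesWeakPullbacks H)
    {X Z : PartOrd.{u}} {α : kl Φ X ⟶ kl Φ (H.obj X)} (hα : PreservesUpgrades F α) {n : ℕ}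
    {e : kl Φ X ⟶ kl Φ Z} (he : IsOutput E α n e) :
    IsCondBisimulation F α fun φ x y => slice φ e x = slice φ e y :=
  ⟨fun _ _ hle _ _ h => he.slice_eq_of_le F hα hle h, fun φ =>
    hH.isBisimulation_ker _ (slice φ e) fun _ _ h => he.map_versionCoalg_eq F hα h⟩

/-- The output of the algorithm characterises conditional bisimilarity. -/
theorem IsOutput.condBisimilar_iff (F : VersionFilter E) (hH : PreservesWeakPullbacks H)
    {X Z : PartOrd.{u}} {α : kl Φ X ⟶ kl Φ (H.obj X)} (hα : PreservesUpgrades F α) {n : ℕ}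
    {e : kl Φ X ⟶ kl Φ Z} (he : IsOutput E α n e) (φ : Φ) (x y : X) :
    CondBisimilar F α φ x y ↔ slice φ e x = slice φ e y := by
  constructor
  · rintro ⟨R, hR, h⟩
    exact he.1.slice_eq_of_isCondCongruence F hα hR.isCondCongruence φ x y h
  · exact fun h => ⟨_, he.isCondBisimulation_ker F hH hα, h⟩

end General

/-! ### Preservation of injections and weak pullbacks by the functors of transition systems -/

section Preservation

theorem PreservesInjections.comp {G H : PartOrd.{u} ⥤ PartOrd.{u}} (hG : PreservesInjections G)
    (hH : PreservesInjections H) : PreservesInjections (G ⋙ H) :=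
  fun X Y m hm => hH _ _ _ (hG X Y m hm)

theorem PreservesWeakPullbacks.comp {G H : PartOrd.{u} ⥤ PartOrd.{u}}
    (hG : PreservesWeakPullbacks G) (hH : PreservesWeakPullbacks H) :
    PreservesWeakPullbacks (G ⋙ H) :=
  fun _ _ _ _ _ _ _ _ h => hH _ _ _ _ _ _ _ _ (hG _ _ _ _ _ _ _ _ h)

theorem preservesInjections_pow : PreservesInjections powFunctor.{u} :=
  fun _ _ _ hm => Set.image_injective.mpr hm

theorem preservesInjections_dual : PreservesInjections PartOrd.dual.{u} :=
  fun _ _ _ hm => hm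

theorem preservesInjections_exp (A : Type u) : PreservesInjections (expFunctor A) :=
  fun _ _ _ hm _ _ h => funext fun a => hm (congrFun h a)

theorem preservesInjections_prod (Φ : Type u) [PartialOrder Φ] :
    PreservesInjections (prodFunctor Φ) :=
  fun X Y m hm (p q : X × Φ) (h : ((m p.1, p.2) : Y × Φ) = (m q.1, q.2)) =>
    Prod.ext (hm (Prod.mk.inj h).1) (Prod.mk.inj h).2

/-- Testing against the one-point poset shows that a weak pullback covers all matching pairs of
points. -/
theorem IsWeakPullback.exists_eq {P X Y Z : PartOrd.{u}} {f₁ : P ⟶ X} {f₂ : P ⟶ Y}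
    {g₁ : X ⟶ Z} {g₂ : Y ⟶ Z} (h : IsWeakPullback f₁ f₂ g₁ g₂) {x : X} {y : Y}
    (hxy : g₁ x = g₂ y) : ∃ p, f₁ p = x ∧ f₂ p = y := by
  obtain ⟨d, h₁, h₂⟩ := h.2 (PartOrd.of PUnit.{u + 1})
    (PartOrd.ofHom (X := PUnit.{u + 1}) (Y := X) (OrderHom.const _ x))
    (PartOrd.ofHom (X := PUnit.{u + 1}) (Y := Y) (OrderHom.const _ y))
    (PartOrd.ext fun _ => hxy)
  exact ⟨d PUnit.unit, congrArg (fun k : PartOrd.of PUnit.{u + 1} ⟶ X => k PUnit.unit) h₁,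
    congrArg (fun k : PartOrd.of PUnit.{u + 1} ⟶ Y => k PUnit.unit) h₂⟩

theorem preservesWeakPullbacks_pow : PreservesWeakPullbacks powFunctor.{u} := by
  intro P X Y Z f₁ f₂ g₁ g₂ hP
  refine ⟨by rw [← Functor.map_comp, hP.1, Functor.map_comp], fun W h₁ h₂ h => ?_⟩
  let S₁ : W →o Set X := h₁.hom
  let S₂ : W →o Set Y := h₂.hom
  have hW : ∀ w, g₁ '' S₁ w = g₂ '' S₂ w := fun w =>
    congrArg (fun k : W ⟶ powFunctor.obj Z => k w) h
  -- The largest candidate is taken: all of its members project into both sets, it is monotone in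
  -- `w` without any choice, and the equality of images supplies the partners that make the
  -- projections onto.
  refine ⟨PartOrd.ofHom (X := W) (Y := Set P)
    ⟨fun w => {p | f₁ p ∈ S₁ w ∧ f₂ p ∈ S₂ w},
      fun _ _ hle _ hp => ⟨S₁.monotone hle hp.1, S₂.monotone hle hp.2⟩⟩,
    PartOrd.ext fun w => Set.ext fun x => ⟨?_, fun hx => ?_⟩,
    PartOrd.ext fun w => Set.ext fun y => ⟨?_, fun hy => ?_⟩⟩
  · rintro ⟨p, hp, rfl⟩
    exact hp.1
  · obtain ⟨y, hy, hxy⟩ : g₁ x ∈ g₂ '' S₂ w := hW w ▸ ⟨x, hx, rfl⟩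
    obtain ⟨p, rfl, rfl⟩ := hP.exists_eq hxy.symm
    exact ⟨p, ⟨hx, hy⟩, rfl⟩
  · rintro ⟨p, hp, rfl⟩
    exact hp.2
  · obtain ⟨x, hx, hxy⟩ : g₂ y ∈ g₁ '' S₁ w := hW w ▸ ⟨y, hy, rfl⟩
    obtain ⟨p, rfl, rfl⟩ := hP.exists_eq hxy
    exact ⟨p, ⟨hx, hy⟩, rfl⟩

theorem preservesWeakPullbacks_dual : PreservesWeakPullbacks PartOrd.dual.{u} := by
  intro P X Y Z f₁ f₂ g₁ g₂ hP
  refine ⟨by rw [← Functor.map_comp, hP.1, Functor.map_comp], fun W h₁ h₂ h => ?_⟩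
  -- Dualising a cone moves the reversed order to its apex, and the mediating map is transported
  -- back.
  obtain ⟨d, hd₁, hd₂⟩ := hP.2 (PartOrd.of Wᵒᵈ)
    (PartOrd.ofHom (X := Wᵒᵈ) (Y := X) ⟨fun w => OrderDual.ofDual (h₁ (OrderDual.ofDual w)),
      fun _ _ hle => h₁.hom.monotone hle⟩)
    (PartOrd.ofHom (X := Wᵒᵈ) (Y := Y) ⟨fun w => OrderDual.ofDual (h₂ (OrderDual.ofDual w)),
      fun _ _ hle => h₂.hom.monotone hle⟩)
    (PartOrd.ext fun w =>
      congrArg (fun k : W ⟶ PartOrd.dual.obj Z => k (OrderDual.ofDual w)) h)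
  exact ⟨PartOrd.ofHom (X := W) (Y := Pᵒᵈ) ⟨fun w => OrderDual.toDual (d (OrderDual.toDual w)),
      fun _ _ hle => d.hom.monotone hle⟩,
    PartOrd.ext fun w => congrArg (fun k : PartOrd.of Wᵒᵈ ⟶ X => k (OrderDual.toDual w)) hd₁,
    PartOrd.ext fun w => congrArg (fun k : PartOrd.of Wᵒᵈ ⟶ Y => k (OrderDual.toDual w)) hd₂⟩

theorem preservesWeakPullbacks_exp (A : Type u) : PreservesWeakPullbacks (expFunctor A) := by
  intro P X Y Z f₁ f₂ g₁ g₂ hP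
  refine ⟨by rw [← Functor.map_comp, hP.1, Functor.map_comp], fun W h₁ h₂ h => ?_⟩
  have hA (a : A) := hP.2 W
    (PartOrd.ofHom (X := W) (Y := X) ⟨fun w => (h₁ w : A → X) a,
      fun _ _ hle => h₁.hom.monotone hle a⟩)
    (PartOrd.ofHom (X := W) (Y := Y) ⟨fun w => (h₂ w : A → Y) a,
      fun _ _ hle => h₂.hom.monotone hle a⟩)
    (PartOrd.ext fun w =>
      congrArg (fun k : W ⟶ (expFunctor A).obj Z => (k w : A → Z) a) h)
  -- The mediating maps can be chosen independently, because `A` carries no order that they would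
  -- have to respect.
  choose d hd₁ hd₂ using hA
  exact ⟨PartOrd.ofHom (X := W) (Y := A → P) ⟨fun w a => d a w,
      fun _ _ hle a => (d a).hom.monotone hle⟩,
    PartOrd.ext fun w => funext fun a => congrArg (fun k : W ⟶ X => k w) (hd₁ a),
    PartOrd.ext fun w => funext fun a => congrArg (fun k : W ⟶ Y => k w) (hd₂ a)⟩

theorem preservesWeakPullbacks_prod (Φ : Type u) [PartialOrder Φ] :
    PreservesWeakPullbacks (prodFunctor Φ) := by
  intro P X Y Z f₁ f₂ g₁ g₂ hP
  refine ⟨by rw [← Functor.map_comp, hP.1, Functor.map_comp], fun W h₁ h₂ h => ?_⟩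
  have hW : ∀ w, ((g₁ (h₁ w : X × Φ).1, (h₁ w : X × Φ).2) : Z × Φ) =
      (g₂ (h₂ w : Y × Φ).1, (h₂ w : Y × Φ).2) := fun w =>
    congrArg (fun k : W ⟶ (prodFunctor Φ).obj Z => k w) h
  obtain ⟨d, hd₁, hd₂⟩ := hP.2 W
    (PartOrd.ofHom (X := W) (Y := X) ⟨fun w => (h₁ w : X × Φ).1,
      fun _ _ hle => (h₁.hom.monotone hle).1⟩)
    (PartOrd.ofHom (X := W) (Y := Y) ⟨fun w => (h₂ w : Y × Φ).1,
      fun _ _ hle => (h₂.hom.monotone hle).1⟩)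
    (PartOrd.ext fun w => (Prod.mk.inj (hW w)).1)
  -- The versions in `h₁ w` and `h₂ w` agree by `hW`, so either may be used.
  exact ⟨PartOrd.ofHom (X := W) (Y := P × Φ) ⟨fun w => (d w, (h₁ w : X × Φ).2),
      fun _ _ hle => ⟨d.hom.monotone hle, (h₁.hom.monotone hle).2⟩⟩,
    PartOrd.ext fun w => Prod.ext (congrArg (fun k : W ⟶ X => k w) hd₁) rfl,
    PartOrd.ext fun w => Prod.ext (congrArg (fun k : W ⟶ Y => k w) hd₂)
      (Prod.mk.inj (hW w)).2⟩

variable (A Φ : Type u) [PartialOrder Φ]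

theorem preservesInjections_cts : PreservesInjections (ctsFunctor A) :=
  preservesInjections_pow.comp (preservesInjections_exp A)

theorem preservesWeakPullbacks_cts : PreservesWeakPullbacks (ctsFunctor A) :=
  preservesWeakPullbacks_pow.comp (preservesWeakPullbacks_exp A)

theorem preservesInjections_ctsDual : PreservesInjections (ctsDualFunctor A) :=
  preservesInjections_pow.comp (preservesInjections_dual.comp (preservesInjections_exp A))

theorem preservesWeakPullbacks_ctsDual : PreservesWeakPullbacks (ctsDualFunctor A) :=
  preservesWeakPullbacks_pow.comp
    (preservesWeakPullbacks_dual.comp (preservesWeakPullbacks_exp A))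

theorem preservesInjections_ctsUpgrade : PreservesInjections (ctsUpgradeFunctor A Φ) :=
  (preservesInjections_prod Φ).comp (preservesInjections_cts A)

theorem preservesWeakPullbacks_ctsUpgrade : PreservesWeakPullbacks (ctsUpgradeFunctor A Φ) :=
  (preservesWeakPullbacks_prod Φ).comp (preservesWeakPullbacks_cts A)

end Preservation

/-! ### Conditional transition systems, with upgrades -/

section CTS

variable {Φ A X : Type u} [PartialOrder Φ]

/-- If the coalgebraic conditional bisimulations are conditional bisimulations on the CTS and
these are conditional congruences, then the output characterises bisimilarity on the CTS. -/
theorem IsOutput.cts_bisimilar_iff {H : PartOrd.{u} ⥤ PartOrd.{u}} {E : KlExtension Φ H}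
    (F : VersionFilter E) (hH : PreservesWeakPullbacks H) (f : CTS Φ A X)
    {α : kl Φ (discr X) ⟶ kl Φ (H.obj (discr X))} (hα : PreservesUpgrades F α)
    (hbisim : ∀ R, IsCondBisimulation F α R → f.IsCondBisimulation R)
    (hcong : ∀ R, f.IsCondBisimulation R → IsCondCongruence F α R) {n : ℕ} {Z : PartOrd.{u}}
    {e : kl Φ (discr X) ⟶ kl Φ Z} (he : IsOutput E α n e) (φ : Φ) (x y : X) :
    f.Bisimilar φ x y ↔
      slice (X := discr X) (Y := Z) φ e x = slice (X := discr X) (Y := Z) φ e y := by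
  constructor
  · rintro ⟨R, hR, h⟩
    exact he.1.slice_eq_of_isCondCongruence F hα (hcong R hR) φ x y h
  · exact fun h => ⟨_, hbisim _ (he.isCondBisimulation_ker F hH hα), h⟩

/-- Two sets whose elements are matched by `R` have the same image in the quotient by `R`. -/
theorem image_quotMap_eq {X : PartOrd.{u}} {R : X → X → Prop} {S T : Set X}
    (h₁ : ∀ x ∈ S, ∃ y ∈ T, R x y) (h₂ : ∀ y ∈ T, ∃ x ∈ S, R x y) :
    quotMap X R '' S = quotMap X R '' T := by
  apply Set.ext
  intro z
  constructor
  · rintro ⟨x, hx, rfl⟩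
    obtain ⟨y, hy, h⟩ := h₁ x hx
    exact ⟨y, hy, (quotMap_eq X R h).symm⟩
  · rintro ⟨y, hy, rfl⟩
    obtain ⟨x, hx, h⟩ := h₂ y hy
    exact ⟨x, hx, quotMap_eq X R h⟩

/-- Two sets that are the images of one set of pairs have their elements matched. -/
theorem matched_of_image_eq {P Q : Type u} {p₁ p₂ : P → Q} {S T : Set Q} {U : Set P}
    (h₁ : S = p₁ '' U) (h₂ : T = p₂ '' U) :
    (∀ x ∈ S, ∃ y ∈ T, ∃ s, p₁ s = x ∧ p₂ s = y) ∧
      ∀ y ∈ T, ∃ x ∈ S, ∃ s, p₁ s = x ∧ p₂ s = y := by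
  subst h₁ h₂
  constructor
  · rintro _ ⟨s, hs, rfl⟩
    exact ⟨_, ⟨s, hs, rfl⟩, s, rfl, rfl⟩
  · rintro _ ⟨s, hs, rfl⟩
    exact ⟨_, ⟨s, hs, rfl⟩, s, rfl, rfl⟩

/-- Filtering for `ψ` fixes the tag to be `ψ`; the condition of the coalgebra then reads `ψ ≤ φ`. If
it holds, the remaining set does not depend on `φ`; if it fails, the set is empty. -/
theorem CTS.preservesUpgrades_upgradeCoalg (f : CTS Φ A X) :
    PreservesUpgrades ctsUpgradeFilter f.upgradeCoalg := by
  constructor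
  · intro ψ φ hle
    refine PartOrd.ext fun x => funext fun a => Set.ext fun z => ?_
    constructor
    · rintro ⟨⟨h, -⟩, hz⟩
      exact ⟨⟨h, hz.le⟩, hz⟩
    · rintro ⟨⟨h, -⟩, hz⟩
      exact ⟨⟨h, hz.le.trans hle⟩, hz⟩
  · intro ψ φ hle x y
    refine funext fun a => Set.ext fun z => ?_
    constructor
    · rintro ⟨⟨-, h⟩, hz⟩
      exact absurd (hz.ge.trans h) hle
    · rintro ⟨⟨-, h⟩, hz⟩
      exact absurd (hz.ge.trans h) hle

/-- Up to the constant tag `φ`, the version coalgebra is the labelled transition system of `φ`,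
which reduces both comparisons below to plain sets of successors. -/
theorem CTS.versionCoalg_upgradeCoalg (f : CTS Φ A X) (φ : Φ) (x : X) (a : A) :
    (versionCoalg ctsUpgradeFilter f.upgradeCoalg φ x : A → Set (X × Φ)) a =
      (fun x' => (x', φ)) '' f.next x a φ := by
  apply Set.ext
  rintro ⟨x', φ'⟩
  constructor
  · rintro ⟨⟨h, -⟩, hz⟩
    obtain rfl : φ' = φ := hz
    exact ⟨x', h, rfl⟩
  · rintro ⟨_, h, hz⟩
    cases hz
    exact ⟨⟨h, le_rfl⟩, rfl⟩

theorem CTS.isCondBisimulation_of_upgradeCoalg (f : CTS Φ A X) (R : Φ → X → X → Prop)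
    (hR : CondTS.IsCondBisimulation ctsUpgradeFilter f.upgradeCoalg R) :
    f.IsCondBisimulation R := by
  refine ⟨fun φ x y h a => ?_, hR.1⟩
  obtain ⟨P, p₁, p₂, r, -, hP, h₁, h₂⟩ := hR.2 φ
  obtain ⟨s, rfl, rfl⟩ := (hP x y).mp h
  have e₁ : (fun x' => (x', φ)) '' f.next (p₁ s) a φ =
      (fun q : P × Φ => ((p₁ q.1 : X), q.2)) '' ((r s : A → Set (P × Φ)) a) :=
    (f.versionCoalg_upgradeCoalg φ (p₁ s) a).symm.trans
      (congrArg (fun k : P ⟶ (ctsUpgradeFunctor A Φ).obj (discr X) =>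
        (k s : A → Set (X × Φ)) a) h₁)
  have e₂ : (fun x' => (x', φ)) '' f.next (p₂ s) a φ =
      (fun q : P × Φ => ((p₂ q.1 : X), q.2)) '' ((r s : A → Set (P × Φ)) a) :=
    (f.versionCoalg_upgradeCoalg φ (p₂ s) a).symm.trans
      (congrArg (fun k : P ⟶ (ctsUpgradeFunctor A Φ).obj (discr X) =>
        (k s : A → Set (X × Φ)) a) h₂)
  -- Matching happens on tagged states; the first component of the witness `t` lies in `P` and
  -- relates the untagged ones.
  obtain ⟨k₁, k₂⟩ := matched_of_image_eq e₁ e₂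
  constructor
  · intro x' hx'
    obtain ⟨_, ⟨y', hy', rfl⟩, t, ht₁, ht₂⟩ := k₁ _ ⟨x', hx', rfl⟩
    exact ⟨y', hy', (hP x' y').mpr ⟨t.1, congrArg Prod.fst ht₁, congrArg Prod.fst ht₂⟩⟩
  · intro y' hy'
    obtain ⟨_, ⟨x', hx', rfl⟩, t, ht₁, ht₂⟩ := k₂ _ ⟨y', hy', rfl⟩
    exact ⟨x', hx', (hP x' y').mpr ⟨t.1, congrArg Prod.fst ht₁, congrArg Prod.fst ht₂⟩⟩

theorem CTS.IsCondBisimulation.isCondCongruence_upgradeCoalg {f : CTS Φ A X}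
    {R : Φ → X → X → Prop} (hR : f.IsCondBisimulation R) :
    IsCondCongruence ctsUpgradeFilter f.upgradeCoalg R := by
  refine ⟨hR.2, fun φ x y h => funext fun a => ?_⟩
  -- `H κ` leaves tags alone, so the value is the tagged `κ`-image of the successor set, to which
  -- `image_quotMap_eq` applies.
  have key : ∀ x : X,
      ((versionCoalg ctsUpgradeFilter f.upgradeCoalg φ ≫
        (ctsUpgradeFunctor A Φ).map (quotMap (discr X) (R φ))) x :
          A → Set (posetQuot (discr X) (R φ) × Φ)) a =
      (fun z => (z, φ)) '' (quotMap (discr X) (R φ) '' f.next x a φ) := by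
    intro x
    refine (congrArg (fun S : Set (X × Φ) =>
      (fun q : X × Φ => (quotMap (discr X) (R φ) q.1, q.2)) '' S)
      (f.versionCoalg_upgradeCoalg φ x a)).trans ?_
    exact (Set.image_image _ _ _).trans
      (Set.image_image (fun z => (z, φ)) (quotMap (discr X) (R φ)) (f.next x a φ)).symm
  refine (key x).trans (Eq.trans ?_ (key y).symm)
  rw [image_quotMap_eq (X := discr X) (hR.1 φ x y h a).1 (hR.1 φ x y h a).2]

/-! ### Conditional transition systems over a discrete order of conditions -/

variable (hΦ : ∀ φ ψ : Φ, φ ≤ ψ → φ = ψ)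

/-- For a discrete order of conditions every coalgebra preserves upgrades. -/
theorem preservesUpgrades_discreteFilter {H : PartOrd.{u} ⥤ PartOrd.{u}}
    (z : ∀ Y : PartOrd.{u}, H.obj Y) (hz : ∀ (Y Z : PartOrd.{u}) (f : Y ⟶ Z), H.map f (z Y) = z Z)
    {X : PartOrd.{u}} (α : kl Φ X ⟶ kl Φ (H.obj X)) :
    PreservesUpgrades (discreteFilter hΦ H z hz) α := by
  constructor
  · intro ψ φ hle
    rw [hΦ ψ φ hle]
  · intro ψ φ hle x y
    -- Off its own version the filter returns the default element, whatever the state.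
    have h : ¬ φ = ψ := fun h => hle h.ge
    exact (if_neg h).trans (if_neg h).symm

theorem versionCoalg_discreteFilter {H : PartOrd.{u} ⥤ PartOrd.{u}}
    (z : ∀ Y : PartOrd.{u}, H.obj Y) (hz : ∀ (Y Z : PartOrd.{u}) (f : Y ⟶ Z), H.map f (z Y) = z Z)
    {X : PartOrd.{u}} (α : kl Φ X ⟶ kl Φ (H.obj X)) (φ : Φ) :
    versionCoalg (discreteFilter hΦ H z hz) α φ = slice φ α :=
  PartOrd.ext fun _ => if_pos rfl

theorem versionCoalg_ctsFilter {X : PartOrd.{u}} (α : kl Φ X ⟶ kl Φ ((ctsFunctor A).obj X))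
    (φ : Φ) : versionCoalg (ctsFilter hΦ) α φ = slice φ α :=
  versionCoalg_discreteFilter hΦ _ _ α φ

theorem versionCoalg_ctsDualFilter {X : PartOrd.{u}}
    (α : kl Φ X ⟶ kl Φ ((ctsDualFunctor A).obj X)) (φ : Φ) :
    versionCoalg (ctsDualFilter hΦ) α φ = slice φ α :=
  versionCoalg_discreteFilter hΦ _ _ α φ

/-- Only equalities of images enter, never the order on subsets, so this serves both `P(-)^A` and
its order dual. -/
theorem CTS.isCondBisimulation_of_forall_image {f : CTS Φ A X} {R : Φ → X → X → Prop}
    (hmono : ∀ ψ φ : Φ, ψ ≤ φ → ∀ x y, R φ x y → R ψ x y)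
    (h : ∀ φ x y, R φ x y → ∀ a, ∃ (P : Type u) (p₁ p₂ : P → X) (U : Set P),
      (∀ s, R φ (p₁ s) (p₂ s)) ∧ f.next x a φ = p₁ '' U ∧ f.next y a φ = p₂ '' U) :
    f.IsCondBisimulation R := by
  refine ⟨fun φ x y hxy a => ?_, hmono⟩
  obtain ⟨P, p₁, p₂, U, hP, h₁, h₂⟩ := h φ x y hxy a
  obtain ⟨k₁, k₂⟩ := matched_of_image_eq h₁ h₂
  constructor
  · intro x' hx'
    obtain ⟨y', hy', s, rfl, rfl⟩ := k₁ x' hx'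
    exact ⟨_, hy', hP s⟩
  · intro y' hy'
    obtain ⟨x', hx', s, rfl, rfl⟩ := k₂ y' hy'
    exact ⟨_, hx', hP s⟩

theorem CTS.isCondBisimulation_of_coalg (f : CTS Φ A X) (R : Φ → X → X → Prop)
    (hR : CondTS.IsCondBisimulation (ctsFilter hΦ) (f.coalg hΦ) R) :
    f.IsCondBisimulation R := by
  refine CTS.isCondBisimulation_of_forall_image hR.1 fun φ x y h a => ?_
  obtain ⟨P, p₁, p₂, r, -, hP, h₁, h₂⟩ := hR.2 φ
  obtain ⟨s, rfl, rfl⟩ := (hP x y).mp h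
  rw [versionCoalg_ctsFilter] at h₁ h₂
  -- The coalgebra structure of the span, at `s` and `a`, is the set of pairs whose two images are
  -- the successor sets.
  exact ⟨P, p₁, p₂, (r s : A → Set P) a, fun t => (hP _ _).mpr ⟨t, rfl, rfl⟩,
    congrArg (fun k : P ⟶ (ctsFunctor A).obj (discr X) => (k s : A → Set X) a) h₁,
    congrArg (fun k : P ⟶ (ctsFunctor A).obj (discr X) => (k s : A → Set X) a) h₂⟩

theorem CTS.isCondBisimulation_of_dualCoalg (f : CTS Φ A X) (R : Φ → X → X → Prop)
    (hR : CondTS.IsCondBisimulation (ctsDualFilter hΦ) f.dualCoalg R) :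
    f.IsCondBisimulation R := by
  refine CTS.isCondBisimulation_of_forall_image hR.1 fun φ x y h a => ?_
  obtain ⟨P, p₁, p₂, r, -, hP, h₁, h₂⟩ := hR.2 φ
  obtain ⟨s, rfl, rfl⟩ := (hP x y).mp h
  rw [versionCoalg_ctsDualFilter] at h₁ h₂
  exact ⟨P, p₁, p₂, OrderDual.ofDual ((r s : A → (Set P)ᵒᵈ) a),
    fun t => (hP _ _).mpr ⟨t, rfl, rfl⟩,
    congrArg (fun k : P ⟶ (ctsDualFunctor A).obj (discr X) =>
      OrderDual.ofDual ((k s : A → (Set X)ᵒᵈ) a)) h₁,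
    congrArg (fun k : P ⟶ (ctsDualFunctor A).obj (discr X) =>
      OrderDual.ofDual ((k s : A → (Set X)ᵒᵈ) a)) h₂⟩

theorem CTS.IsCondBisimulation.isCondCongruence_coalg {f : CTS Φ A X}
    {R : Φ → X → X → Prop} (hR : f.IsCondBisimulation R) :
    IsCondCongruence (ctsFilter hΦ) (f.coalg hΦ) R := by
  refine ⟨hR.2, fun φ x y h => ?_⟩
  rw [versionCoalg_ctsFilter]
  exact funext fun a =>
    image_quotMap_eq (X := discr X) (hR.1 φ x y h a).1 (hR.1 φ x y h a).2

theorem CTS.IsCondBisimulation.isCondCongruence_dualCoalg {f : CTS Φ A X}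
    {R : Φ → X → X → Prop} (hR : f.IsCondBisimulation R) :
    IsCondCongruence (ctsDualFilter hΦ) f.dualCoalg R := by
  refine ⟨hR.2, fun φ x y h => ?_⟩
  rw [versionCoalg_ctsDualFilter]
  exact funext fun a => congrArg OrderDual.toDual
    (image_quotMap_eq (X := discr X) (hR.1 φ x y h a).1 (hR.1 φ x y h a).2)

end CTS

end CondTS

theorem mainTheorem3 :
    (∀ (Φ : Type u) [PartialOrder Φ] (H : PartOrd.{u} ⥤ PartOrd.{u})
      (E : CondTS.KlExtension Φ H) (F : CondTS.VersionFilter E),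
      CondTS.PreservesInjections H →
      ∀ (X : PartOrd.{u}) (α : CondTS.kl Φ X ⟶ CondTS.kl Φ (H.obj X)),
      CondTS.PreservesUpgrades F α →
      ∀ (n : ℕ) (Z : PartOrd.{u}) (e : CondTS.kl Φ X ⟶ CondTS.kl Φ Z),
      CondTS.IsOutput E α n e →
      ∀ (φ : Φ) (x₁ x₂ : X),
        (CondTS.CondCongruent F α φ x₁ x₂ ↔
          CondTS.uncurry e (x₁, φ) = CondTS.uncurry e (x₂, φ)) ∧
        (CondTS.PreservesWeakPullbacks H →
          (CondTS.CondBisimilar F α φ x₁ x₂ ↔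
            CondTS.uncurry e (x₁, φ) = CondTS.uncurry e (x₂, φ)))) ∧
    (∀ (Φ A X : Type u) [PartialOrder Φ] (f : CondTS.CTS Φ A X),
      CondTS.PreservesInjections (CondTS.ctsUpgradeFunctor A Φ) ∧
      CondTS.PreservesWeakPullbacks (CondTS.ctsUpgradeFunctor A Φ) ∧
      CondTS.PreservesUpgrades CondTS.ctsUpgradeFilter f.upgradeCoalg ∧
      ∀ (n : ℕ) (Z : PartOrd.{u}) (e : CondTS.kl Φ (CondTS.discr X) ⟶ CondTS.kl Φ Z),
        CondTS.IsOutput (CondTS.ctsUpgradeExtension Φ A) f.upgradeCoalg n e →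
        ∀ (φ : Φ) (x₁ x₂ : X),
          f.Bisimilar φ x₁ x₂ ↔ CondTS.uncurry e (x₁, φ) = CondTS.uncurry e (x₂, φ)) ∧
    (∀ (Φ A X : Type u) [PartialOrder Φ] (hΦ : ∀ φ ψ : Φ, φ ≤ ψ → φ = ψ) (f : CondTS.CTS Φ A X),
      CondTS.PreservesInjections (CondTS.ctsFunctor A) ∧
      CondTS.PreservesWeakPullbacks (CondTS.ctsFunctor A) ∧
      CondTS.PreservesUpgrades (CondTS.ctsFilter hΦ) (f.coalg hΦ) ∧
      ∀ (n : ℕ) (Z : PartOrd.{u}) (e : CondTS.kl Φ (CondTS.discr X) ⟶ CondTS.kl Φ Z),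
        CondTS.IsOutput (CondTS.discreteExtension hΦ (CondTS.ctsFunctor A)) (f.coalg hΦ) n e →
        ∀ (φ : Φ) (x₁ x₂ : X),
          f.Bisimilar φ x₁ x₂ ↔ CondTS.uncurry e (x₁, φ) = CondTS.uncurry e (x₂, φ)) ∧
    (∀ (Φ A X : Type u) [PartialOrder Φ] (hΦ : ∀ φ ψ : Φ, φ ≤ ψ → φ = ψ) (f : CondTS.CTS Φ A X),
      CondTS.PreservesInjections (CondTS.ctsDualFunctor A) ∧
      CondTS.PreservesWeakPullbacks (CondTS.ctsDualFunctor A) ∧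
      CondTS.PreservesUpgrades (CondTS.ctsDualFilter hΦ) f.dualCoalg ∧
      ∀ (n : ℕ) (Z : PartOrd.{u}) (e : CondTS.kl Φ (CondTS.discr X) ⟶ CondTS.kl Φ Z),
        CondTS.IsOutput (CondTS.discreteExtension hΦ (CondTS.ctsDualFunctor A)) f.dualCoalg n e →
        ∀ (φ : Φ) (x₁ x₂ : X),
          f.Bisimilar φ x₁ x₂ ↔ CondTS.uncurry e (x₁, φ) = CondTS.uncurry e (x₂, φ)) := by
  refine ⟨?_, ?_, ?_, ?_⟩
  · intro Φ _ H E F hH X α hα n Z e he φ x₁ x₂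
    -- `uncurry e (x, φ)` and `slice φ e x` agree by definition.
    exact ⟨he.condCongruent_iff F hH hα φ x₁ x₂,
      fun hW => he.condBisimilar_iff F hW hα φ x₁ x₂⟩
  · intro Φ A X _ f
    refine ⟨CondTS.preservesInjections_ctsUpgrade A Φ, CondTS.preservesWeakPullbacks_ctsUpgrade A Φ,
      f.preservesUpgrades_upgradeCoalg, fun n Z e he φ x₁ x₂ => ?_⟩
    exact he.cts_bisimilar_iff CondTS.ctsUpgradeFilter
      (CondTS.preservesWeakPullbacks_ctsUpgrade A Φ) f f.preservesUpgrades_upgradeCoalg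
      f.isCondBisimulation_of_upgradeCoalg (fun _ hR => hR.isCondCongruence_upgradeCoalg) φ x₁ x₂
  · intro Φ A X _ hΦ f
    have hα : CondTS.PreservesUpgrades (CondTS.ctsFilter hΦ) (f.coalg hΦ) :=
      CondTS.preservesUpgrades_discreteFilter hΦ _ _ _
    refine ⟨CondTS.preservesInjections_cts A, CondTS.preservesWeakPullbacks_cts A, hα,
      fun n Z e he φ x₁ x₂ => ?_⟩
    exact he.cts_bisimilar_iff _ (CondTS.preservesWeakPullbacks_cts A) f hα
      (f.isCondBisimulation_of_coalg hΦ) (fun _ hR => hR.isCondCongruence_coalg hΦ) φ x₁ x₂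
  · intro Φ A X _ hΦ f
    have hα : CondTS.PreservesUpgrades (CondTS.ctsDualFilter hΦ) f.dualCoalg :=
      CondTS.preservesUpgrades_discreteFilter hΦ _ _ _
    refine ⟨CondTS.preservesInjections_ctsDual A, CondTS.preservesWeakPullbacks_ctsDual A, hα,
      fun n Z e he φ x₁ x₂ => ?_⟩
    exact he.cts_bisimilar_iff _ (CondTS.preservesWeakPullbacks_ctsDual A) f hα
      (f.isCondBisimulation_of_dualCoalg hΦ) (fun _ hR => hR.isCondCongruence_dualCoalg hΦ) φ x₁ x₂
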